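/- Let $(X,\mathcal B,\mu)$ be a measure space with $\mu(X)=\infty$ and $\mu$ diffuse: every $A\in\mathcal B$ with $\mu(A)>0$ has a measurable subset $B\subset A$ with $\mu(B)=\mu(A)/2$. Let $\alpha\ge 1$ and let $\psi\in\Psi$, i.e. $\psi:[\alpha,\infty)\to(0,\infty)$ is continuous and strictly increasing, $\psi(p)\to\infty$ as $p\to\infty$, and $p\mapsto p\log\psi(p)$ is convex on $[\alpha,\infty)$. Let $G(\alpha;\psi)$ be the Grand Lebesgue Space with norm $\|f\|_{G(\alpha;\psi)}=\sup_{p\ge\alpha}|f|_p/\psi(p)$, where $|f|_p$ is the $L_p(\mu)$ norm, and let $$\phi(\delta)=\sup_{p\ge\alpha}\frac{\delta^{1/p}}{\psi(p)},\qquad \delta>0,$$ be its fundamental function. A Young–Orlicz function is an even, convex, continuous $N:\mathbb R\to\mathbb R$, strictly increasing on $[0,\infty)$, with $N(u)=0\iff u=0$ and $N(u)/u\to\infty$ as $u\to\infty$. Let $N([\psi])$ denote any Young–Orlicz function with $$N([\psi])(u)=\exp\Big(\sup_{p\ge\alpha}\big(p\log u-p\log\psi(p)\big)\Big),\qquad u\ge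 e^2 .$$ For such $N=N([\psi])$ let $N^{(\alpha)}$ denote any Young–Orlicz function for which there are constants $C_1,C_4>0$, $C_3\in\mathbb R$, $0<C_2<C_5$ with $N^{(\alpha)}(u)=C_1|u|^\alpha$ for $|u|\le C_2$, $N^{(\alpha)}(u)=C_3+C_4|u|$ for $C_2<|u|\le C_5$, and $N^{(\alpha)}(u)=N(u)$ for $|u|>C_5$. Let $(N^{(\alpha)})^{(-1)}$ be the inverse of $N^{(\alpha)}$ on $[0,\infty)$ and put $$\theta_\psi(\delta)=\frac{1}{(N^{(\alpha)})^{(-1)}(1/\delta)},\qquad \delta>0.$$ Then: 1. $\|\mathbf 1_E\|_{G(\alpha;\psi)}=\phi(\delta)$ for every $\delta\in(0,\infty)$ and every measurable $E$ with $\mu(E)=\delta$; and if $\mu$ is $\sigma$-finite, such $E$ exists for every $\delta\in(0,\infty)$. 2. There is a function $N([\psi])$, and for every choice of $N=N([\psi])$ there is a function $N^{(\alpha)}$. 3. For every choice of $N=N([\psi])$ and of $N^{(\alpha)}$, $\phi$ and $\theta_\psi$ are two-sided equivalent on $(0,\infty)$: there are constants $0<c,C<\infty$ such that $$c\,\theta_\psi(\delta)\le\phi(\delta)\le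 C\,\theta_\psi(\delta)\qquad\text{for all }\delta\in(0,\infty).$$ -/

import Mathlib

noncomputable section

namespace GrandLebesgue

open MeasureTheory Set Filter
open scoped ENNReal

/-- A measure is diffuse if every measurable set of positive measure has a measurable subset of
half its measure. -/
def IsDiffuse {X : Type*} [MeasurableSpace X] (μ : Measure X) : Prop :=
  ∀ A : Set X, MeasurableSet A → 0 < μ A →
    ∃ B : Set X, B ⊆ A ∧ MeasurableSet B ∧ μ B = μ A / 2

/-- The class `Ψ` of generating functions on `[α, ∞)`. Values of `ψ` below `α` are irrelevant. -/
structure IsGenerating (α : ℝ) (ψ : ℝ → ℝ) : Prop where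
  continuousOn : ContinuousOn ψ (Ici α)
  pos : ∀ p, α ≤ p → 0 < ψ p
  strictMonoOn : StrictMonoOn ψ (Ici α)
  convexOn : ConvexOn ℝ (Ici α) (fun p => p * Real.log (ψ p))
  tendsto : Tendsto ψ atTop atTop

/-- The norm of the Grand Lebesgue Space `G(α; ψ)`, with values in `[0, ∞]`:
the supremum over real `p ≥ α` of `|f|_p / ψ(p)`. -/
def glsNorm {X : Type*} [MeasurableSpace X] (μ : Measure X) (α : ℝ) (ψ : ℝ → ℝ) (f : X → ℂ) :
    ℝ≥0∞ :=
  ⨆ p ∈ Ici α, eLpNorm f (ENNReal.ofReal p) μ / ENNReal.ofReal (ψ p)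

/-- The fundamental function of `G(α; ψ)`: the supremum over real `p ≥ α` of `δ^{1/p} / ψ(p)`. -/
def fundamentalFunction (α : ℝ) (ψ : ℝ → ℝ) (δ : ℝ) : ℝ :=
  sSup ((fun p : ℝ => δ ^ (1 / p) / ψ p) '' Ici α)

/-- The Young-Fenchel (Legendre) transform of a function `g` supported on `S`. -/
def youngFenchel (S : Set ℝ) (g : ℝ → ℝ) (q : ℝ) : ℝ :=
  sSup ((fun p : ℝ => p * |q| - g p) '' S)

/-- Young-Orlicz functions: even, convex, continuous, strictly increasing on the right semi-axis,
vanishing exactly at `0`, with superlinear growth. (For a convex function vanishing at `0`,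
superlinear growth says exactly that the one-sided derivatives tend to infinity.) -/
structure IsYoungOrlicz (N : ℝ → ℝ) : Prop where
  even : ∀ u, N (-u) = N u
  convexOn : ConvexOn ℝ univ N
  continuous : Continuous N
  strictMonoOn : StrictMonoOn N (Ici 0)
  eq_zero_iff : ∀ u, N u = 0 ↔ u = 0
  superlinear : Tendsto (fun u => N u / u) atTop atTop

/-- `N` is a Young-Orlicz function `N([ψ])` attached to `ψ` :
`N(u) = exp ([p log ψ(p)]^* (log u))` for `u ≥ e²`, and `N` is arbitrary on `[-e², e²]` subject to
being a Young-Orlicz function. -/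
def IsExponentialOrlicz (α : ℝ) (ψ N : ℝ → ℝ) : Prop :=
  IsYoungOrlicz N ∧
    ∀ u : ℝ, Real.exp 2 ≤ u →
      N u = Real.exp (youngFenchel (Ici α) (fun p => p * Real.log (ψ p)) (Real.log u))

/-- `Nα` is a modification `N^{(α)}` of `N` : a Young-Orlicz function that is `C₁ |u|^α` near `0`,
affine in `|u|` on an intermediate range, and equal to `N` for large `|u|`. -/
def IsModification (α : ℝ) (N Nα : ℝ → ℝ) : Prop :=
  IsYoungOrlicz Nα ∧
    ∃ C₁ C₂ C₃ C₄ C₅ : ℝ, 0 < C₁ ∧ 0 < C₂ ∧ 0 < C₄ ∧ C₂ < C₅ ∧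
      (∀ u : ℝ, |u| ≤ C₂ → Nα u = C₁ * |u| ^ α) ∧
      (∀ u : ℝ, C₂ < |u| → |u| ≤ C₅ → Nα u = C₃ + C₄ * |u|) ∧
      (∀ u : ℝ, C₅ < |u| → Nα u = N u)

/-- `θ(δ) = 1 / N^{(-1)}(1/δ)`, where `N^{(-1)}` is the inverse of the function `N` on `[0, ∞)`. -/
def theta (N : ℝ → ℝ) (δ : ℝ) : ℝ :=
  1 / Function.invFunOn N (Ici 0) (1 / δ)

end GrandLebesgue

end

namespace GrandLebesgue

open MeasureTheory Set Filter
open scoped ENNReal Topology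

/-! Let `v` solve `Nα v = 1 / δ`, so that `theta Nα δ = 1 / v`. For large `v` the exponential
formula says that the supremum of `p log v - p log ψ(p)` is `-log δ`. Dividing by `p`, every term
`δ^(1/p) / ψ(p)` is at most `1 / v`, and a near-maximiser gives at least `1 / (2 v)` because `p ≥ 1`
(`fundamentalFunction_bounds_of_exp_eq`). For bounded `v`, `δ` stays away from `0` and both sides
are comparable with `δ^(1/α)`: `Nα` behaves like a power on bounded intervals
(`exists_rpow_bounds`), and the exponent `p = α` dominates the fundamental function
(`fundamentalFunction_le_of_le`).

For existence, `N([ψ])` is the supremum of the convex functions `(|u| / ψ p)^p`, and `N^{(α)}` is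
glued from a power, a supporting line of `N` and `N` itself. Sets of prescribed measure come from
repeated bisection. -/

/-! ### Convex functions on the line: gluing and supporting lines. -/

theorem convexOn_univ_of_slopes_le {f : ℝ → ℝ}
    (h : ∀ x y z : ℝ, x < y → y < z → ∃ m, f y - f x ≤ m * (y - x) ∧ m * (z - y) ≤ f z - f y) :
    ConvexOn ℝ univ f := by
  refine convexOn_of_slope_mono_adjacent convex_univ fun {x y z} _ _ hxy hyz => ?_
  obtain ⟨m, h₁, h₂⟩ := h x y z hxy hyz
  exact ((div_le_iff₀ (sub_pos.2 hxy)).2 h₁).trans ((le_div_iff₀ (sub_pos.2 hyz)).2 h₂)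

theorem exists_slope_of_convexOn {f : ℝ → ℝ} (hf : ConvexOn ℝ univ f) {x y z : ℝ}
    (hxy : x < y) (hyz : y < z) : ∃ m, f y - f x = m * (y - x) ∧ m * (z - y) ≤ f z - f y := by
  have := hf.slope_mono_adjacent (mem_univ x) (mem_univ z) hxy hyz
  refine ⟨(f y - f x) / (y - x), ?_, (le_div_iff₀ (sub_pos.2 hyz)).1 this⟩
  rw [div_mul_cancel₀ _ (sub_pos.2 hxy).ne']

/-- Two convex functions that agree at `c` and lie above a common line through that point on the
respective sides of `c` can be glued to a convex function. -/
theorem convexOn_ite_le {f g : ℝ → ℝ} (hf : ConvexOn ℝ univ f) (hg : ConvexOn ℝ univ g)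
    {c m : ℝ} (hc : f c = g c) (hfm : ∀ x ≤ c, f c + m * (x - c) ≤ f x)
    (hgm : ∀ x, c ≤ x → g c + m * (x - c) ≤ g x) :
    ConvexOn ℝ univ (fun x => if x ≤ c then f x else g x) := by
  refine convexOn_univ_of_slopes_le fun x y z hxy hyz => ?_
  rcases le_or_gt z c with hz | hz
  · obtain ⟨s, h₁, h₂⟩ := exists_slope_of_convexOn hf hxy hyz
    refine ⟨s, ?_, ?_⟩ <;>
      simp only [if_pos hz, if_pos (hyz.le.trans hz), if_pos ((hxy.trans hyz).le.trans hz)] <;>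
      linarith
  rcases lt_or_ge c x with hx | hx
  · obtain ⟨s, h₁, h₂⟩ := exists_slope_of_convexOn hg hxy hyz
    refine ⟨s, ?_, ?_⟩ <;>
      simp only [if_neg hx.not_ge, if_neg (hx.trans hxy).not_ge,
        if_neg (hx.trans (hxy.trans hyz)).not_ge] <;>
      linarith
  have hgz := hgm z hz.le
  have hfx := hfm x hx
  rcases lt_trichotomy y c with hy | rfl | hy
  · obtain ⟨s, h₁, h₂⟩ := exists_slope_of_convexOn hf hxy hy
    have hfy := hfm y hy.le
    -- Since `f` lies above the line at `y`, its slope from `y` to `c` is at most `m`; hence so is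
    -- `s`, and passing to `g` beyond `c` can only increase slopes.
    have hsm : s ≤ m := by
      by_contra! h
      nlinarith [mul_pos (sub_pos.2 h) (sub_pos.2 hy)]
    refine ⟨s, ?_, ?_⟩
    · simp only [if_pos hy.le, if_pos hx]; linarith
    · simp only [if_pos hy.le, if_neg hz.not_ge]
      nlinarith [mul_nonneg (sub_nonneg.2 hsm) (sub_pos.2 hz).le]
  · refine ⟨m, ?_, ?_⟩
    · simp only [if_pos le_rfl, if_pos hx]; linarith
    · simp only [if_pos le_rfl, if_neg hz.not_ge]; linarith
  · obtain ⟨s, h₁, h₂⟩ := exists_slope_of_convexOn hg hy hyz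
    have hgy := hgm y hy.le
    have hsm : m ≤ s := by
      by_contra! h
      nlinarith [mul_pos (sub_pos.2 h) (sub_pos.2 hy)]
    refine ⟨s, ?_, ?_⟩
    · simp only [if_neg hy.not_ge, if_pos hx]
      nlinarith [mul_nonneg (sub_nonneg.2 hsm) (sub_nonneg.2 hx)]
    · simp only [if_neg hy.not_ge, if_neg hz.not_ge]; linarith

/-- The right derivative serves as `m`: it is below all slopes to the right of `c` and, being at
least the left derivative, above all slopes to the left. -/
theorem exists_subgradient_of_convexOn {f : ℝ → ℝ} (hf : ConvexOn ℝ univ f) (c : ℝ) :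
    ∃ m, ∀ x, f c + m * (x - c) ≤ f x := by
  have hc : c ∈ interior (univ : Set ℝ) := by simp
  refine ⟨derivWithin f (Ioi c) c, fun x => ?_⟩
  rcases lt_trichotomy x c with h | rfl | h
  · have h₁ := (hf.slope_le_leftDeriv_of_mem_interior (mem_univ x) hc h).trans
      (hf.leftDeriv_le_rightDeriv_of_mem_interior hc)
    rw [slope_def_field, div_le_iff₀ (sub_pos.2 h)] at h₁
    linarith
  · simp
  · have h₁ := hf.rightDeriv_le_slope_of_mem_interior hc (mem_univ x) h
    rw [slope_def_field, le_div_iff₀ (sub_pos.2 h)] at h₁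
    linarith

theorem le_mul_of_convexOn_of_map_zero {f : ℝ → ℝ} (hf : ConvexOn ℝ univ f) (h0 : f 0 = 0)
    {t : ℝ} (ht₀ : 0 ≤ t) (ht₁ : t ≤ 1) (x : ℝ) : f (t * x) ≤ t * f x := by
  have := hf.2 (mem_univ x) (mem_univ 0) ht₀ (sub_nonneg.2 ht₁) (by ring)
  simpa [h0] using this

theorem convexOn_comp_abs {f : ℝ → ℝ} (hf : ConvexOn ℝ univ f) (hmono : MonotoneOn f (Ici 0)) :
    ConvexOn ℝ univ (fun x => f |x|) := by
  refine ⟨convex_univ, fun x _ y _ a b ha hb hab => ?_⟩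
  have h := hf.2 (mem_univ |x|) (mem_univ |y|) ha hb hab
  refine le_trans (hmono (mem_Ici.2 (abs_nonneg _)) ?_ ?_) h
  · simp only [smul_eq_mul, mem_Ici]; positivity
  · simp only [smul_eq_mul]
    refine (abs_add_le _ _).trans ?_
    rw [abs_mul, abs_mul, abs_of_nonneg ha, abs_of_nonneg hb]

theorem convexOn_abs_rpow {p : ℝ} (hp : 1 ≤ p) : ConvexOn ℝ univ (fun x : ℝ => |x| ^ p) := by
  refine ⟨convex_univ, fun x _ y _ a b ha hb hab => ?_⟩
  refine le_trans (Real.rpow_le_rpow (abs_nonneg _) ?_ (by linarith))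
    ((convexOn_rpow hp).2 (abs_nonneg x) (abs_nonneg y) ha hb hab)
  simp only [smul_eq_mul]
  refine (abs_add_le _ _).trans ?_
  rw [abs_mul, abs_mul, abs_of_nonneg ha, abs_of_nonneg hb]

/-! ### Young-Orlicz functions and the existence of `N^{(α)}`. -/

theorem IsYoungOrlicz.of_convexOn {N : ℝ → ℝ} (even : ∀ u, N (-u) = N u)
    (convexOn : ConvexOn ℝ univ N) (zero : N 0 = 0) (pos : ∀ u, 0 < u → 0 < N u)
    (superlinear : Tendsto (fun u => N u / u) atTop atTop) : IsYoungOrlicz N where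
  even := even
  convexOn := convexOn
  continuous := by
    rw [← continuousOn_univ]
    exact ConvexOn.continuousOn isOpen_univ convexOn
  strictMonoOn := by
    intro x hx y hy hxy
    have hy0 : 0 < y := lt_of_le_of_lt hx hxy
    have h1 := le_mul_of_convexOn_of_map_zero convexOn zero (div_nonneg hx hy0.le)
      ((div_le_one hy0).2 hxy.le) y
    rw [div_mul_cancel₀ _ hy0.ne'] at h1
    refine h1.trans_lt ?_
    have := pos y hy0
    have h2 : x / y < 1 := (div_lt_one hy0).2 hxy
    nlinarith
  eq_zero_iff := by
    intro u
    refine ⟨fun h => ?_, fun h => h ▸ zero⟩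
    rcases lt_trichotomy u 0 with hu | hu | hu
    · have := pos (-u) (by linarith)
      rw [even] at this
      linarith
    · exact hu
    · exact absurd h (pos u hu).ne'
  superlinear := superlinear

namespace IsYoungOrlicz

variable {N : ℝ → ℝ}

theorem map_zero (hN : IsYoungOrlicz N) : N 0 = 0 := (hN.eq_zero_iff 0).2 rfl

theorem pos (hN : IsYoungOrlicz N) {u : ℝ} (hu : 0 < u) : 0 < N u := by
  simpa [hN.map_zero] using hN.strictMonoOn (mem_Ici.2 le_rfl) (mem_Ici.2 hu.le) hu

theorem tendsto_atTop (hN : IsYoungOrlicz N) : Tendsto N atTop atTop := by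
  refine tendsto_atTop_mono' atTop ?_ hN.superlinear
  filter_upwards [eventually_ge_atTop 1] with u hu
  exact div_le_self (hN.pos (by linarith)).le hu

theorem exists_eq (hN : IsYoungOrlicz N) {y : ℝ} (hy : 0 ≤ y) : ∃ u ∈ Ici (0 : ℝ), N u = y := by
  obtain ⟨b, hb, hb0⟩ := ((hN.tendsto_atTop.eventually_ge_atTop y).and
    (eventually_ge_atTop 0)).exists
  obtain ⟨u, hu, h⟩ := intermediate_value_Icc hb0 hN.continuous.continuousOn
    (show y ∈ Icc (N 0) (N b) from ⟨by rwa [hN.map_zero], hb⟩)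
  exact ⟨u, hu.1, h⟩

/-- `theta N δ = 1 / v`, where `v` is the positive solution of `N v = 1 / δ`. -/
theorem exists_theta_eq (hN : IsYoungOrlicz N) {δ : ℝ} (hδ : 0 < δ) :
    ∃ v, 0 < v ∧ N v = 1 / δ ∧ theta N δ = 1 / v := by
  have h := hN.exists_eq (y := 1 / δ) (by positivity)
  have hmem := Function.invFunOn_mem h
  have heq := Function.invFunOn_eq h
  refine ⟨_, lt_of_le_of_ne hmem fun h0 => ?_, heq, rfl⟩
  rw [← h0, hN.map_zero] at heq
  exact (one_div_pos.2 hδ).ne heq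

end IsYoungOrlicz

/-- A power function, a line and a given Young-Orlicz function can be glued to a Young-Orlicz
function. -/
theorem IsYoungOrlicz.exists_isModification {N : ℝ → ℝ} (hN : IsYoungOrlicz N) {α : ℝ}
    (hα : 1 ≤ α) : ∃ Nα : ℝ → ℝ, IsModification α N Nα := by
  -- The condition `N c > c * N 1` forces the supporting line at `c` to vanish at a positive point
  -- `a`.
  obtain ⟨c, hc, hc1⟩ := ((hN.superlinear.eventually_gt_atTop (N 1)).and
    (eventually_gt_atTop 1)).exists
  have hc0 : 0 < c := by linarith
  rw [lt_div_iff₀ hc0] at hc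
  obtain ⟨m, hm⟩ := exists_subgradient_of_convexOn hN.convexOn c
  have hm1 := hm 1
  have hNc := hN.pos hc0
  have hN1 := hN.pos one_pos
  have hmpos : 0 < m := by
    have : N 1 < N c := hN.strictMonoOn (by simp) (by simpa using hc0.le) hc1
    by_contra! h
    nlinarith
  -- the zero of the supporting line at `c`
  set a : ℝ := c - N c / m with ha
  have hma : m * a = m * c - N c := by rw [ha]; field_simp
  have hapos : 0 < a := by
    by_contra! h
    have h1 : m ≤ N 1 := by nlinarith
    nlinarith
  have hac : a < c := by
    have : 0 < N c / m := by positivity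
    linarith
  -- The power that meets the line at `b` has slope `α * m * (b - a) / b` there; the last condition
  -- says that this is at most `m`, so the corner at `b` is convex.
  obtain ⟨b, hab, hbc, hbα⟩ : ∃ b, a < b ∧ b < c ∧ (α - 1) * b ≤ α * a := by
    refine ⟨a + min (a / α) ((c - a) / 2), ?_, ?_, ?_⟩
    · have : 0 < min (a / α) ((c - a) / 2) := lt_min (by positivity) (by linarith)
      linarith
    · have := min_le_right (a / α) ((c - a) / 2)
      linarith
    · have h1 := mul_le_mul_of_nonneg_left (min_le_left (a / α) ((c - a) / 2))
        (sub_nonneg.2 hα)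
      have h2 : (α - 1) * (a / α) = a - a / α := by field_simp
      have h3 : 0 < a / α := by positivity
      nlinarith
  have hb0 : 0 < b := hapos.trans hab
  have hbα0 : 0 < b ^ α := Real.rpow_pos_of_pos hb0 _
  set k : ℝ := m * (b - a) / b ^ α with hk
  have hkpos : 0 < k := by
    have := sub_pos.2 hab
    positivity
  have hkb : k * b ^ α = m * (b - a) := by rw [hk]; field_simp
  have hline : ConvexOn ℝ univ (fun x : ℝ => m * (x - a)) := by
    refine convexOn_univ_of_slopes_le fun x y z _ _ => ⟨m, ?_, ?_⟩ <;> linarith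
  have hpow : ConvexOn ℝ univ (fun x : ℝ => k * |x| ^ α) := by
    simpa using (convexOn_abs_rpow hα).smul hkpos.le
  -- Bernoulli's inequality gives the supporting line of the power at `b`
  have hbern : ∀ x ≤ b, k * |b| ^ α + m * (x - b) ≤ k * |x| ^ α := by
    intro x hx
    rw [abs_of_pos hb0, hkb]
    rcases lt_or_ge x 0 with hx0 | hx0
    · have : 0 ≤ k * |x| ^ α := by positivity
      nlinarith
    have h1 := one_add_mul_self_le_rpow_one_add (s := x / b - 1) (p := α)
      (by have : 0 ≤ x / b := by positivity
          linarith) hα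
    rw [add_sub_cancel, Real.div_rpow hx0 hb0.le, le_div_iff₀ hbα0] at h1
    have h2 := mul_le_mul_of_nonneg_left h1 hkpos.le
    have h3 : k * ((1 + α * (x / b - 1)) * b ^ α) = m * (b - a) * (1 + α * (x / b - 1)) := by
      rw [← hkb]; ring
    rw [h3] at h2
    rw [abs_of_nonneg hx0]
    refine le_trans ?_ h2
    have h4 : m * (b - a) * (1 + α * (x / b - 1)) - (m * (b - a) + m * (x - b))
        = m / b * ((b - x) * (α * a - (α - 1) * b)) := by
      field_simp
      ring
    have h5 : 0 ≤ m / b * ((b - x) * (α * a - (α - 1) * b)) :=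
      mul_nonneg (by positivity) (mul_nonneg (by linarith) (by linarith))
    linarith
  set F : ℝ → ℝ := fun x => if x ≤ b then k * |x| ^ α else m * (x - a) with hF
  have hFconv : ConvexOn ℝ univ F := by
    refine convexOn_ite_le hpow hline (m := m) ?_ hbern ?_
    · rw [abs_of_pos hb0, hkb]
    · intro x _; linarith
  have hFline : ∀ x, m * (x - a) ≤ F x := by
    intro x
    simp only [hF]
    split_ifs with h
    · have := hbern x h
      rw [abs_of_pos hb0, hkb] at this
      linarith
    · exact le_rfl
  have hFc : F c = N c := by
    simp only [hF, if_neg hbc.not_ge]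
    linarith
  set G : ℝ → ℝ := fun x => if x ≤ c then F x else N x with hG
  have hGconv : ConvexOn ℝ univ G := by
    refine convexOn_ite_le hFconv hN.convexOn (m := m) hFc ?_ fun x _ => hm x
    intro x _
    have := hFline x
    rw [hFc]
    linarith
  have hα0 : α ≠ 0 := by linarith
  have hG0 : G 0 = 0 := by
    simp [hG, hF, hc0.le, hb0.le, Real.zero_rpow hα0]
  have hGpos : ∀ u, 0 < u → 0 < G u := by
    intro u hu
    simp only [hG, hF]
    split_ifs with h1 h2
    · have := abs_pos.2 hu.ne'
      positivity
    · exact mul_pos hmpos (by linarith)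
    · exact hN.pos hu
  have hGmono : MonotoneOn G (Ici 0) := by
    intro x hx y hy hxy
    rcases hxy.eq_or_lt with rfl | hlt
    · exact le_rfl
    have hy0 : 0 < y := lt_of_le_of_lt hx hlt
    have h1 := le_mul_of_convexOn_of_map_zero hGconv hG0 (div_nonneg hx hy0.le)
      ((div_le_one hy0).2 hxy) y
    rw [div_mul_cancel₀ _ hy0.ne'] at h1
    exact h1.trans (mul_le_of_le_one_left (hGpos y hy0).le ((div_le_one hy0).2 hxy))
  refine ⟨fun u => G |u|, IsYoungOrlicz.of_convexOn (by simp) (convexOn_comp_abs hGconv hGmono)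
    (by simpa using hG0) (fun u hu => by simpa [abs_of_pos hu] using hGpos u hu) ?_,
    k, b, -(m * a), m, c, hkpos, hb0, hmpos, hbc, ?_, ?_, ?_⟩
  · refine hN.superlinear.congr' ?_
    filter_upwards [eventually_gt_atTop c] with u hu
    simp only [abs_of_pos (hc0.trans hu), hG, if_neg hu.not_ge]
  · intro u hu
    simp only [hG, hF, if_pos hu, if_pos (hu.trans hbc.le), abs_abs]
  · intro u hu hu'
    simp only [hG, hF, if_neg hu.not_ge, if_pos hu']
    ring
  · intro u hu
    simp only [hG, if_neg hu.not_ge]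
    rcases abs_choice u with h | h <;> rw [h]
    exact hN.even u

/-! ### Intermediate values of a diffuse measure. -/

section Measure

variable {X : Type*} [MeasurableSpace X] {μ : Measure X}

/-- Bisection step: if `E` and `R` are disjoint with `μ E ≤ δ ≤ μ E + μ R`, then half of `R` can be
moved to `E` or discarded so that these inequalities persist. -/
theorem IsDiffuse.exists_halving (hμ : IsDiffuse μ) {δ : ℝ≥0∞} {E R : Set X}
    (hE : MeasurableSet E) (hR : MeasurableSet R) (hRfin : μ R ≠ ⊤) (hER : Disjoint E R)
    (h₁ : μ E ≤ δ) (h₂ : δ ≤ μ E + μ R) :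
    ∃ E' R' : Set X, MeasurableSet E' ∧ MeasurableSet R' ∧ Disjoint E' R' ∧ E ⊆ E' ∧
      μ E' ≤ δ ∧ δ ≤ μ E' + μ R' ∧ μ R' = μ R / 2 := by
  rcases eq_or_ne (μ R) 0 with h0 | h0
  · exact ⟨E, R, hE, hR, hER, Subset.rfl, h₁, h₂, by simp [h0]⟩
  obtain ⟨B, hBR, hB, hBμ⟩ := hμ R hR (pos_iff_ne_zero.2 h0)
  have hdiff : μ (R \ B) = μ R / 2 := by
    rw [measure_sdiff hBR hB.nullMeasurableSet (ne_top_of_le_ne_top hRfin (measure_mono hBR)), hBμ]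
    exact ENNReal.sub_half hRfin
  rcases le_total (μ E + μ R / 2) δ with h | h
  · have hEB : μ (E ∪ B) = μ E + μ R / 2 := by
      rw [measure_union (hER.mono_right hBR) hB, hBμ]
    refine ⟨E ∪ B, R \ B, hE.union hB, hR.diff hB, ?_, subset_union_left, hEB.trans_le h, ?_, hdiff⟩
    · exact disjoint_union_left.2 ⟨hER.mono_right sdiff_subset, disjoint_sdiff_right⟩
    · rw [hEB, hdiff, add_assoc, ENNReal.add_halves]
      exact h₂
  · exact ⟨E, B, hE, hB, hER.mono_right hBR, Subset.rfl, h₁, by rwa [hBμ], hBμ⟩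

/-- A diffuse measure takes all intermediate values below a set of finite measure. -/
theorem IsDiffuse.exists_measure_eq (hμ : IsDiffuse μ) {δ : ℝ≥0∞} {F : Set X}
    (hF : MeasurableSet F) (hFfin : μ F ≠ ⊤) (hδ : δ ≤ μ F) :
    ∃ E : Set X, MeasurableSet E ∧ μ E = δ := by
  -- A state is a set already accepted together with a reserve still to be split; the reserve's
  -- measure halves at each step, so the union of the accepted sets has measure exactly `δ`.
  let S := {q : Set X × Set X // MeasurableSet q.1 ∧ MeasurableSet q.2 ∧ Disjoint q.1 q.2 ∧
    μ q.2 ≠ ⊤ ∧ μ q.1 ≤ δ ∧ δ ≤ μ q.1 + μ q.2}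
  have step : ∀ q : S, ∃ q' : S, q.1.1 ⊆ q'.1.1 ∧ μ q'.1.2 = μ q.1.2 / 2 := by
    rintro ⟨⟨E, R⟩, hE, hR, hER, hfin, h₁, h₂⟩
    obtain ⟨E', R', hE', hR', hER', hsub, h₁', h₂', hhalf⟩ :=
      hμ.exists_halving hE hR hfin hER h₁ h₂
    exact ⟨⟨(E', R'), hE', hR', hER', by
      simp only [hhalf]; exact ENNReal.div_ne_top hfin two_ne_zero, h₁', h₂'⟩, hsub, hhalf⟩
  choose next hsub hhalf using step
  let q₀ : S := ⟨(∅, F), .empty, hF, disjoint_bot_left, hFfin, by simp, by simpa using hδ⟩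
  let q : ℕ → S := fun n => next^[n] q₀
  have hq : ∀ n, q (n + 1) = next (q n) := fun n => Function.iterate_succ_apply' _ _ _
  have hmono : Monotone fun n => (q n).1.1 :=
    monotone_nat_of_le_succ fun n => by rw [hq]; exact hsub _
  have hR : ∀ n, μ (q n).1.2 = μ F * (2⁻¹ : ℝ≥0∞) ^ n := by
    intro n
    induction n with
    | zero => simp [q, q₀]
    | succ n ih => rw [hq, hhalf, ih, pow_succ, div_eq_mul_inv, mul_assoc]
  have hRlim : Tendsto (fun n => μ (q n).1.2) atTop (𝓝 0) := by
    simp_rw [hR]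
    have := ENNReal.Tendsto.const_mul (a := μ F)
      (ENNReal.tendsto_pow_atTop_nhds_zero_of_lt_one (r := 2⁻¹) (by simp)) (Or.inr hFfin)
    simpa using this
  have hElim : Tendsto (fun n => μ (q n).1.1) atTop (𝓝 (μ (⋃ n, (q n).1.1))) :=
    tendsto_measure_iUnion_atTop hmono
  refine ⟨⋃ n, (q n).1.1, .iUnion fun n => (q n).2.1, le_antisymm ?_ ?_⟩
  · exact le_of_tendsto' hElim fun n => (q n).2.2.2.2.2.1
  · have := hElim.add hRlim
    rw [add_zero] at this
    exact ge_of_tendsto' this fun n => (q n).2.2.2.2.2.2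

theorem IsDiffuse.exists_measure_eq_of_sigmaFinite [SigmaFinite μ] (hμ : IsDiffuse μ)
    (hinf : μ univ = ⊤) {δ : ℝ≥0∞} (hδ : δ ≠ ⊤) : ∃ E : Set X, MeasurableSet E ∧ μ E = δ := by
  have hlim : Tendsto (fun n => μ (spanningSets μ n)) atTop (𝓝 ⊤) := by
    rw [← hinf, ← iUnion_spanningSets μ]
    exact tendsto_measure_iUnion_atTop (monotone_spanningSets μ)
  obtain ⟨n, hn⟩ := (hlim.eventually (lt_mem_nhds (lt_top_iff_ne_top.2 hδ))).exists
  exact hμ.exists_measure_eq (measurableSet_spanningSets μ n)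
    (measure_spanningSets_lt_top μ n).ne hn.le

end Measure

/-! ### The fundamental function and norms of indicators. -/

section Fundamental

variable {α : ℝ} {ψ : ℝ → ℝ}

theorem IsGenerating.le_of_le (hψ : IsGenerating α ψ) {p : ℝ} (hp : α ≤ p) : ψ α ≤ ψ p :=
  hψ.strictMonoOn.monotoneOn (mem_Ici.2 le_rfl) (mem_Ici.2 hp) hp

/-- Once the base is raised to at least `1`, the largest exponent `1 / α` is the worst case, which
gives a bound uniform in `p`. -/
theorem rpow_one_div_le_max_one {α δ p : ℝ} (hα : 1 ≤ α) (hδ : 0 < δ) (hp : α ≤ p) :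
    δ ^ (1 / p) ≤ max 1 δ ^ (1 / α) := by
  have hp0 : 0 < p := by linarith
  exact (Real.rpow_le_rpow hδ.le (le_max_right 1 δ) (by positivity)).trans
    (Real.rpow_le_rpow_of_exponent_le (le_max_left 1 δ) (one_div_le_one_div_of_le (by linarith) hp))

theorem IsGenerating.rpow_div_le (hψ : IsGenerating α ψ) (hα : 1 ≤ α) {δ p : ℝ} (hδ : 0 < δ)
    (hp : α ≤ p) : δ ^ (1 / p) / ψ p ≤ max 1 δ ^ (1 / α) / ψ α :=
  div_le_div₀ (by positivity) (rpow_one_div_le_max_one hα hδ hp) (hψ.pos α le_rfl) (hψ.le_of_le hp)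

theorem IsGenerating.bddAbove_fundamental (hψ : IsGenerating α ψ) (hα : 1 ≤ α) {δ : ℝ}
    (hδ : 0 < δ) : BddAbove ((fun p : ℝ => δ ^ (1 / p) / ψ p) '' Ici α) := by
  refine ⟨max 1 δ ^ (1 / α) / ψ α, ?_⟩
  rintro _ ⟨p, hp, rfl⟩
  exact hψ.rpow_div_le hα hδ hp

theorem IsGenerating.le_fundamentalFunction (hψ : IsGenerating α ψ) (hα : 1 ≤ α) {δ p : ℝ}
    (hδ : 0 < δ) (hp : α ≤ p) : δ ^ (1 / p) / ψ p ≤ fundamentalFunction α ψ δ :=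
  le_csSup (hψ.bddAbove_fundamental hα hδ) ⟨p, hp, rfl⟩

theorem fundamentalFunction_le {δ K : ℝ} (h : ∀ p, α ≤ p → δ ^ (1 / p) / ψ p ≤ K) :
    fundamentalFunction α ψ δ ≤ K := by
  refine csSup_le (nonempty_Ici.image _) ?_
  rintro _ ⟨p, hp, rfl⟩
  exact h p hp

theorem IsGenerating.glsNorm_indicator {X : Type*} [MeasurableSpace X] {μ : Measure X}
    (hψ : IsGenerating α ψ) (hα : 1 ≤ α) {δ : ℝ} (hδ : 0 < δ) {E : Set X} (hE : MeasurableSet E)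
    (hμE : μ E = ENNReal.ofReal δ) :
    glsNorm μ α ψ (E.indicator fun _ => (1 : ℂ)) =
      ENNReal.ofReal (fundamentalFunction α ψ δ) := by
  -- Boundedness lets `ENNReal.ofReal` pass through the real supremum, and the two suprema then
  -- agree term by term.
  rw [fundamentalFunction, ENNReal.ofReal_mono.map_csSup_of_continuousAt
    ENNReal.continuous_ofReal.continuousAt (nonempty_Ici.image _)
    (hψ.bddAbove_fundamental hα hδ), image_image, sSup_image, glsNorm]
  refine iSup_congr fun p => iSup_congr fun hp => ?_
  have hp0 : 0 < p := lt_of_lt_of_le (by linarith) hp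
  rw [eLpNorm_indicator_const hE (by simpa using hp0) ENNReal.ofReal_ne_top,
    ENNReal.toReal_ofReal hp0.le, hμE, ENNReal.ofReal_rpow_of_pos hδ,
    ENNReal.ofReal_div_of_pos (hψ.pos p hp)]
  simp

/-- On `[δ₀, ∞)` the fundamental function is comparable with `δ ^ (1 / α)`. -/
theorem IsGenerating.fundamentalFunction_le_of_le (hψ : IsGenerating α ψ) (hα : 1 ≤ α) {δ₀ δ : ℝ}
    (hδ₀ : 0 < δ₀) (h : δ₀ ≤ δ) :
    fundamentalFunction α ψ δ ≤ (max 1 (1 / δ₀)) ^ (1 / α) / ψ α * δ ^ (1 / α) := by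
  have hδ : 0 < δ := hδ₀.trans_le h
  refine fundamentalFunction_le fun p hp => (hψ.rpow_div_le hα hδ hp).trans ?_
  rw [div_mul_eq_mul_div, ← Real.mul_rpow (by positivity) hδ.le]
  refine div_le_div_of_nonneg_right (Real.rpow_le_rpow (by positivity) ?_ (by positivity))
    (hψ.pos α le_rfl).le
  refine max_le ?_ (le_mul_of_one_le_left hδ.le (le_max_left _ _))
  calc (1 : ℝ) = 1 / δ₀ * δ₀ := by field_simp
    _ ≤ _ := mul_le_mul (le_max_right _ _) h hδ₀.le (by positivity)

end Fundamental

/-! ### The Young-Fenchel transform and the function `N([ψ])`. -/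

section Young

variable {α : ℝ} {ψ : ℝ → ℝ}

/-- Terms with `ψ p ≥ exp q` are nonpositive, which covers all large `p`; on the remaining bounded
range `log ψ(p)` is at least `log ψ(α)`. -/
theorem IsGenerating.bddAbove_young (hψ : IsGenerating α ψ) (hα : 1 ≤ α) (q : ℝ) :
    BddAbove ((fun p : ℝ => p * q - p * Real.log (ψ p)) '' Ici α) := by
  obtain ⟨P, hP⟩ := eventually_atTop.1 (hψ.tendsto.eventually_ge_atTop (Real.exp q))
  refine ⟨|P| * |q - Real.log (ψ α)|, ?_⟩
  rintro _ ⟨p, hp, rfl⟩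
  have hp0 : 0 < p := lt_of_lt_of_le (by linarith) hp
  have hlog : Real.log (ψ α) ≤ Real.log (ψ p) :=
    Real.log_le_log (hψ.pos α le_rfl) (hψ.le_of_le hp)
  simp only [← mul_sub]
  rcases le_total P p with h | h
  · have h1 : q ≤ Real.log (ψ p) := (Real.le_log_iff_exp_le (hψ.pos p hp)).2 (hP p h)
    exact (mul_nonpos_of_nonneg_of_nonpos hp0.le (sub_nonpos.2 h1)).trans (by positivity)
  · calc p * (q - Real.log (ψ p)) ≤ p * |q - Real.log (ψ α)| :=
          mul_le_mul_of_nonneg_left (le_trans (by linarith) (le_abs_self _)) hp0.le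
      _ ≤ _ := mul_le_mul_of_nonneg_right (h.trans (le_abs_self P)) (abs_nonneg _)

theorem youngFenchel_of_nonneg {S : Set ℝ} {g : ℝ → ℝ} {q : ℝ} (hq : 0 ≤ q) :
    youngFenchel S g q = sSup ((fun p : ℝ => p * q - g p) '' S) := by
  rw [youngFenchel, abs_of_nonneg hq]

/-- The function `u ↦ sup_p (|u| / ψ p) ^ p`. -/
noncomputable def powerSup (α : ℝ) (ψ : ℝ → ℝ) (u : ℝ) : ℝ :=
  sSup ((fun p : ℝ => (|u| / ψ p) ^ p) '' Ici α)

theorem IsGenerating.rpow_eq_exp (hψ : IsGenerating α ψ) {u p : ℝ} (hu : u ≠ 0) (hp : α ≤ p) :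
    (|u| / ψ p) ^ p = Real.exp (p * Real.log |u| - p * Real.log (ψ p)) := by
  have hψp := hψ.pos p hp
  have hu' := abs_pos.2 hu
  rw [Real.rpow_def_of_pos (by positivity), Real.log_div hu'.ne' hψp.ne']
  congr 1
  ring

theorem IsGenerating.bddAbove_powerSup (hψ : IsGenerating α ψ) (hα : 1 ≤ α) (u : ℝ) :
    BddAbove ((fun p : ℝ => (|u| / ψ p) ^ p) '' Ici α) := by
  rcases eq_or_ne u 0 with rfl | hu
  · refine ⟨0, ?_⟩
    rintro _ ⟨p, hp, rfl⟩
    have hp0 : p ≠ 0 := by linarith [mem_Ici.1 hp]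
    simp [Real.zero_rpow hp0]
  · obtain ⟨B, hB⟩ := hψ.bddAbove_young hα (Real.log |u|)
    refine ⟨Real.exp B, ?_⟩
    rintro _ ⟨p, hp, rfl⟩
    simp only [hψ.rpow_eq_exp hu hp]
    exact Real.exp_le_exp.2 (hB ⟨p, hp, rfl⟩)

theorem IsGenerating.le_powerSup (hψ : IsGenerating α ψ) (hα : 1 ≤ α) (u : ℝ) {p : ℝ}
    (hp : α ≤ p) : (|u| / ψ p) ^ p ≤ powerSup α ψ u :=
  le_csSup (hψ.bddAbove_powerSup hα u) ⟨p, hp, rfl⟩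

theorem IsGenerating.powerSup_eq_exp (hψ : IsGenerating α ψ) (hα : 1 ≤ α) {u : ℝ} (hu : 1 ≤ u) :
    powerSup α ψ u =
      Real.exp (youngFenchel (Ici α) (fun p => p * Real.log (ψ p)) (Real.log u)) := by
  rw [youngFenchel_of_nonneg (Real.log_nonneg hu),
    Real.exp_monotone.map_csSup_of_continuousAt Real.continuous_exp.continuousAt
      (nonempty_Ici.image _) (hψ.bddAbove_young hα _), image_image, powerSup]
  refine congrArg sSup (image_congr fun p hp => ?_)
  have hu0 : 0 < u := by linarith
  rw [hψ.rpow_eq_exp hu0.ne' hp, abs_of_pos hu0]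

theorem IsGenerating.convexOn_powerSup (hψ : IsGenerating α ψ) (hα : 1 ≤ α) :
    ConvexOn ℝ univ (powerSup α ψ) := by
  refine ⟨convex_univ, fun x _ y _ a b ha hb hab => csSup_le (nonempty_Ici.image _) ?_⟩
  rintro _ ⟨p, hp, rfl⟩
  have hψp := hψ.pos p hp
  have h := (convexOn_abs_rpow (hα.trans hp)).2 (mem_univ (x / ψ p)) (mem_univ (y / ψ p)) ha hb hab
  have hx := hψ.le_powerSup hα x hp
  have hy := hψ.le_powerSup hα y hp
  simp only [smul_eq_mul, abs_div, abs_of_pos hψp] at h ⊢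
  have heq : |a * (x / ψ p) + b * (y / ψ p)| = |a * x + b * y| / ψ p := by
    rw [← abs_of_pos hψp, ← abs_div, abs_of_pos hψp]
    congr 1
    ring
  rw [heq] at h
  exact h.trans (add_le_add (mul_le_mul_of_nonneg_left hx ha) (mul_le_mul_of_nonneg_left hy hb))

theorem IsGenerating.isYoungOrlicz_powerSup (hψ : IsGenerating α ψ) (hα : 1 ≤ α) :
    IsYoungOrlicz (powerSup α ψ) := by
  refine IsYoungOrlicz.of_convexOn (fun u => by simp [powerSup]) (hψ.convexOn_powerSup hα) ?_ ?_ ?_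
  · refine le_antisymm (csSup_le (nonempty_Ici.image _) ?_) ?_
    · rintro _ ⟨p, hp, rfl⟩
      have hp0 : p ≠ 0 := by linarith [mem_Ici.1 hp]
      simp [Real.zero_rpow hp0]
    · refine le_trans ?_ (hψ.le_powerSup hα 0 le_rfl)
      simp [Real.zero_rpow (show α ≠ 0 by linarith)]
  · intro u hu
    refine lt_of_lt_of_le ?_ (hψ.le_powerSup hα u le_rfl)
    have := hψ.pos α le_rfl
    have := abs_pos.2 hu.ne'
    positivity
  -- The single exponent `α + 1` gives superlinear growth; `α` itself might equal `1`.
  · have hp : α ≤ α + 1 := by linarith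
    have hψp := hψ.pos _ hp
    have hlim : Tendsto (fun u : ℝ => u ^ α / ψ (α + 1) ^ (α + 1)) atTop atTop :=
      (tendsto_rpow_atTop (by linarith)).atTop_div_const (by positivity)
    refine tendsto_atTop_mono' atTop ?_ hlim
    filter_upwards [eventually_gt_atTop 0] with u hu
    rw [le_div_iff₀ hu]
    refine le_trans (le_of_eq ?_) (hψ.le_powerSup hα u hp)
    rw [abs_of_pos hu, Real.div_rpow hu.le hψp.le, Real.rpow_add_one hu.ne']
    ring

theorem IsGenerating.exists_isExponentialOrlicz (hψ : IsGenerating α ψ) (hα : 1 ≤ α) :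
    ∃ N : ℝ → ℝ, IsExponentialOrlicz α ψ N :=
  ⟨powerSup α ψ, hψ.isYoungOrlicz_powerSup hα, fun _ hu =>
    hψ.powerSup_eq_exp hα ((Real.one_le_exp zero_le_two).trans hu)⟩

/-- If `v ≥ 1` is related to `δ` by `exp ([p log ψ(p)]^* (log v)) = 1 / δ`, then the fundamental
function at `δ` lies between `1 / (2 v)` and `1 / v`. -/
theorem IsGenerating.fundamentalFunction_bounds_of_exp_eq (hψ : IsGenerating α ψ) (hα : 1 ≤ α)
    {δ v : ℝ} (hδ : 0 < δ) (hv : 1 ≤ v)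
    (h : Real.exp (youngFenchel (Ici α) (fun p => p * Real.log (ψ p)) (Real.log v)) = 1 / δ) :
    1 / 2 * (1 / v) ≤ fundamentalFunction α ψ δ ∧ fundamentalFunction α ψ δ ≤ 1 / v := by
  have hv0 : 0 < v := by linarith
  rw [youngFenchel_of_nonneg (Real.log_nonneg hv)] at h
  have hS := congrArg Real.log h
  rw [Real.log_exp, one_div, Real.log_inv] at hS
  have hexp : ∀ p, α ≤ p → δ ^ (1 / p) / ψ p =
      Real.exp ((Real.log δ - p * Real.log (ψ p)) / p) := by
    intro p hp
    have hp0 : 0 < p := by linarith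
    have hψp := hψ.pos p hp
    rw [Real.rpow_def_of_pos hδ, sub_div, mul_div_cancel_left₀ _ hp0.ne', Real.exp_sub,
      Real.exp_log hψp, mul_one_div]
  constructor
  -- The slack `log 2` avoids needing an attained supremum; after division by `p ≥ 1` it costs at
  -- most a factor `2`.
  · have hlt : -Real.log δ - Real.log 2 <
        sSup ((fun p : ℝ => p * Real.log v - p * Real.log (ψ p)) '' Ici α) := by
      rw [hS]
      linarith [Real.log_pos one_lt_two]
    obtain ⟨_, ⟨p, hp, rfl⟩, hlt⟩ := exists_lt_of_lt_csSup (nonempty_Ici.image _) hlt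
    have hp1 : 1 ≤ p := hα.trans hp
    have hp0 : 0 < p := by linarith
    refine le_trans ?_ (hψ.le_fundamentalFunction hα hδ hp)
    rw [hexp p hp]
    calc 1 / 2 * (1 / v) = Real.exp (-Real.log 2 - Real.log v) := by
          rw [Real.exp_sub, Real.exp_neg, Real.exp_log two_pos, Real.exp_log hv0]
          ring
      _ ≤ _ := by
          refine Real.exp_le_exp.2 ((le_div_iff₀ hp0).2 ?_)
          simp only at hlt
          nlinarith [Real.log_pos one_lt_two]
  · refine fundamentalFunction_le fun p hp => ?_
    have hp0 : 0 < p := by linarith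
    have hle := le_csSup (hψ.bddAbove_young hα (Real.log v)) ⟨p, hp, rfl⟩
    rw [hS] at hle
    simp only at hle
    rw [hexp p hp, one_div, ← Real.exp_log hv0, ← Real.exp_neg]
    refine Real.exp_le_exp.2 ((div_le_iff₀ hp0).2 ?_)
    linarith

end Young

/-- On a bounded interval a modification `N^{(α)}` is comparable with the power `u ^ α`. -/
theorem IsModification.exists_rpow_bounds {α : ℝ} (hα : 0 < α) {N Nα : ℝ → ℝ}
    (h : IsModification α N Nα) (A : ℝ) :
    ∃ k K : ℝ, 0 < k ∧ 0 < K ∧ ∀ v, 0 < v → v ≤ A → k * v ^ α ≤ Nα v ∧ Nα v ≤ K * v ^ α := by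
  obtain ⟨hY, C₁, C₂, -, -, -, hC₁, hC₂, -, -, hpow, -, -⟩ := h
  set B : ℝ := max A C₂ with hB
  have hB0 : 0 < B := hC₂.trans_le (le_max_right _ _)
  have hNB := hY.pos hB0
  have hNC := hY.pos hC₂
  -- On `[C₂, B]` both `Nα` and the power are monotone, so their endpoint values bound the ratio.
  refine ⟨min C₁ (Nα C₂ / B ^ α), max C₁ (Nα B / C₂ ^ α), by positivity, by positivity,
    fun v hv hvA => ?_⟩
  have hvα : 0 < v ^ α := Real.rpow_pos_of_pos hv _
  rcases le_total v C₂ with hvC | hvC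
  · rw [hpow v (by rwa [abs_of_pos hv]), abs_of_pos hv]
    exact ⟨mul_le_mul_of_nonneg_right (min_le_left _ _) hvα.le,
      mul_le_mul_of_nonneg_right (le_max_left _ _) hvα.le⟩
  · have hvB : v ≤ B := hvA.trans (le_max_left _ _)
    have hmono := hY.strictMonoOn.monotoneOn
    constructor
    · calc min C₁ (Nα C₂ / B ^ α) * v ^ α ≤ Nα C₂ / B ^ α * B ^ α :=
            mul_le_mul (min_le_right _ _) (Real.rpow_le_rpow hv.le hvB hα.le) hvα.le (by positivity)
        _ = Nα C₂ := div_mul_cancel₀ _ (by positivity)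
        _ ≤ Nα v := hmono (mem_Ici.2 hC₂.le) (mem_Ici.2 hv.le) hvC
    · calc Nα v ≤ Nα B := hmono (mem_Ici.2 hv.le) (mem_Ici.2 hB0.le) hvB
        _ = Nα B / C₂ ^ α * C₂ ^ α := (div_mul_cancel₀ _ (by positivity)).symm
        _ ≤ _ := mul_le_mul (le_max_right _ _) (Real.rpow_le_rpow hC₂.le hvC hα.le)
            (by positivity) (by positivity)

/-- The fundamental function of `G(α; ψ)` is equivalent to `θ_ψ`. -/
theorem IsGenerating.exists_theta_bounds {α : ℝ} {ψ N Nα : ℝ → ℝ} (hψ : IsGenerating α ψ)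
    (hα : 1 ≤ α) (hN : IsExponentialOrlicz α ψ N) (hNα : IsModification α N Nα) :
    ∃ c C : ℝ, 0 < c ∧ 0 < C ∧ ∀ δ : ℝ, 0 < δ →
      c * theta Nα δ ≤ fundamentalFunction α ψ δ ∧
        fundamentalFunction α ψ δ ≤ C * theta Nα δ := by
  have hα0 : 0 < α := by linarith
  have hψα := hψ.pos α le_rfl
  obtain ⟨hY, -, -, -, -, C₅, -, -, -, -, -, -, hlarge⟩ := id hNα
  -- Beyond `A`, `Nα` equals `N` and `N` is given by the exponential formula; `v ≤ A` corresponds to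
  -- `δ ≥ δ₀`.
  set A : ℝ := max C₅ (Real.exp 2) with hA
  have hA0 : 0 < A := (Real.exp_pos 2).trans_le (le_max_right _ _)
  have hNA := hY.pos hA0
  obtain ⟨k, K, hk, hK, hkK⟩ := hNα.exists_rpow_bounds hα0 A
  set δ₀ : ℝ := 1 / Nα A with hδ₀
  have hδ₀pos : 0 < δ₀ := by positivity
  set B : ℝ := (max 1 (1 / δ₀)) ^ (1 / α) / ψ α with hB
  have hB0 : 0 < B := by positivity
  refine ⟨min (1 / 2) (1 / (K ^ (1 / α) * ψ α)), max 1 (B / k ^ (1 / α)), by positivity,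
    by positivity, fun δ hδ => ?_⟩
  obtain ⟨v, hv, hNv, hθ⟩ := hY.exists_theta_eq hδ
  have hv' : 0 < 1 / v := by positivity
  rw [hθ]
  rcases lt_or_ge A v with hAv | hAv
  · have hexp : Real.exp 2 ≤ v := (le_max_right C₅ _).trans hAv.le
    rw [hlarge v (by rw [abs_of_pos hv]; exact (le_max_left _ _).trans_lt hAv),
      hN.2 v hexp] at hNv
    obtain ⟨h₁, h₂⟩ := hψ.fundamentalFunction_bounds_of_exp_eq hα hδ
      ((Real.one_le_exp zero_le_two).trans hexp) hNv
    exact ⟨(mul_le_mul_of_nonneg_right (min_le_left _ _) hv'.le).trans h₁,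
      h₂.trans (le_mul_of_one_le_left hv'.le (le_max_left _ _))⟩
  · obtain ⟨h₁, h₂⟩ := hkK v hv hAv
    have hδle : δ₀ ≤ δ := by
      have : Nα v ≤ Nα A :=
        hY.strictMonoOn.monotoneOn (mem_Ici.2 hv.le) (mem_Ici.2 hA0.le) hAv
      rw [hNv] at this
      rw [hδ₀]
      exact (one_div_le hδ hNA).1 this
    rw [hNv] at h₁ h₂
    have hroot : ((1 / v) ^ α) ^ (1 / α) = 1 / v := by
      rw [← Real.rpow_mul hv'.le, mul_one_div_cancel hα0.ne', Real.rpow_one]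
    have hpow : (1 / v) ^ α = 1 / v ^ α := by rw [Real.div_rpow zero_le_one hv.le, Real.one_rpow]
    have hvα : 0 < v ^ α := Real.rpow_pos_of_pos hv _
    have hlow : k ^ (1 / α) * δ ^ (1 / α) ≤ 1 / v := by
      rw [← Real.mul_rpow hk.le hδ.le, ← hroot, hpow]
      refine Real.rpow_le_rpow (by positivity) ?_ (by positivity)
      rw [le_div_iff₀ hδ] at h₁
      rw [le_div_iff₀ hvα]
      linarith
    have hupp : 1 / v ≤ K ^ (1 / α) * δ ^ (1 / α) := by
      rw [← Real.mul_rpow hK.le hδ.le, ← hroot, hpow]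
      refine Real.rpow_le_rpow (by positivity) ?_ (by positivity)
      rw [div_le_iff₀ hδ] at h₂
      rw [div_le_iff₀ hvα]
      linarith
    have hKα : 0 < K ^ (1 / α) := by positivity
    have hkα : 0 < k ^ (1 / α) := by positivity
    constructor
    -- For the lower bound the single term `p = α` suffices.
    · calc _ ≤ 1 / (K ^ (1 / α) * ψ α) * (K ^ (1 / α) * δ ^ (1 / α)) :=
            mul_le_mul (min_le_right _ _) hupp hv'.le (by positivity)
        _ = δ ^ (1 / α) / ψ α := by field_simp
        _ ≤ _ := hψ.le_fundamentalFunction hα hδ le_rfl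
    · calc _ ≤ B * δ ^ (1 / α) := hψ.fundamentalFunction_le_of_le hα hδ₀pos hδle
        _ = B / k ^ (1 / α) * (k ^ (1 / α) * δ ^ (1 / α)) := by field_simp
        _ ≤ _ := mul_le_mul (le_max_right _ _) hlow (by positivity) (by positivity)

end GrandLebesgue

theorem proposition3p1 {X : Type*} [MeasurableSpace X] (μ : MeasureTheory.Measure X)
    (hdiff : GrandLebesgue.IsDiffuse μ) (hinf : μ Set.univ = ⊤)
    (α : ℝ) (hα : 1 ≤ α) (ψ : ℝ → ℝ) (hψ : GrandLebesgue.IsGenerating α ψ) :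
    -- the fundamental function is the norm of indicators of sets of measure `δ`
    (∀ (δ : ℝ) (E : Set X), 0 < δ → MeasurableSet E → μ E = ENNReal.ofReal δ →
      GrandLebesgue.glsNorm μ α ψ (E.indicator (fun _ => (1 : ℂ))) =
        ENNReal.ofReal (GrandLebesgue.fundamentalFunction α ψ δ)) ∧
    (MeasureTheory.SigmaFinite μ → ∀ δ : ℝ, 0 < δ →
      ∃ E : Set X, MeasurableSet E ∧ μ E = ENNReal.ofReal δ) ∧
    -- the Orlicz functions `N([ψ])` and `N^{(α)}` exist
    (∃ N : ℝ → ℝ, GrandLebesgue.IsExponentialOrlicz α ψ N) ∧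
    (∀ N : ℝ → ℝ, GrandLebesgue.IsExponentialOrlicz α ψ N →
      (∃ Nα : ℝ → ℝ, GrandLebesgue.IsModification α N Nα) ∧
      -- two-sided equivalence on the whole of `(0, ∞)`, for every choice of `N^{(α)}`
      ∀ Nα : ℝ → ℝ, GrandLebesgue.IsModification α N Nα →
        ∃ c C : ℝ, 0 < c ∧ 0 < C ∧ ∀ δ : ℝ, 0 < δ →
          c * GrandLebesgue.theta Nα δ ≤ GrandLebesgue.fundamentalFunction α ψ δ ∧
          GrandLebesgue.fundamentalFunction α ψ δ ≤ C * GrandLebesgue.theta Nα δ) := by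
  refine ⟨fun δ E hδ hE hμE => hψ.glsNorm_indicator hα hδ hE hμE, fun hσ δ _ => ?_,
    hψ.exists_isExponentialOrlicz hα, fun N hN =>
      ⟨hN.1.exists_isModification hα, fun Nα hNα => hψ.exists_theta_bounds hα hN hNα⟩⟩
  exact hdiff.exists_measure_eq_of_sigmaFinite hinf ENNReal.ofReal_ne_top
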